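/- Let $a_0\ge 1$ be an integer, let $a_k=\frac{1}{2k-1}$ for $k\ge 1$, and put $s(n)=\sum_{k=1}^n a_k$ for $n\ge 0$ (so $s(0)=0$). Let $\mathrm{sinc}(x)=\sin(x)/x$ for $x\neq 0$ and $\mathrm{sinc}(0)=1$. For every integer $n\ge 0$ the integral $$J_n(a_0)=a_0\int_0^\infty\prod_{k=0}^n\mathrm{sinc}(a_kx)\,\mathrm{d}x$$ converges as an improper integral $\lim_{R\to\infty}\int_0^R$, and it converges absolutely if $n\ge 1$. There is exactly one integer $n\ge 1$ with $s(n-1)\le a_0<s(n)$, that is, one index at which the sum first exceeds $a_0$. For this $n$, $$J_n(a_0)=\frac{\pi}{2}\,\bigl(1-t_n(a_0)\bigr),$$ where $$t_n(a_0)=\frac{(s(n)-a_0)^n}{2^{n-1}\,n!\,\prod_{k=1}^n a_k}=\frac{(s(n)-a_0)^n}{2^{2n-1}}\cdot\frac{(2n)!}{(n!)^2}.$$ For every integer $n\ge 0$ with $s(n)\le a_0$, one has $J_n(a_0)=\frac{\pi}{2}$. -/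

import Mathlib

open Filter Topology MeasureTheory

noncomputable section

/-- The sum `s(n) = a₁ + ⋯ + aₙ` (the term `a₀` is not included). -/
def coeffSum (a : ℕ → ℝ) (n : ℕ) : ℝ := ∑ k ∈ Finset.Icc 1 n, a k

/-- The integrand `∏_{k=0}^n sinc(a_k x)`; `Real.sinc` takes the value `1` at `0`. -/
def sincProd (a : ℕ → ℝ) (n : ℕ) (x : ℝ) : ℝ := ∏ k ∈ Finset.range (n + 1), Real.sinc (a k * x)

/-- The integral `∫_0^∞ f(x) dx` converges, as the limit of `∫_0^R f(x) dx` for `R → ∞`. -/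
def ImproperConverges (f : ℝ → ℝ) : Prop :=
  (∀ R : ℝ, IntervalIntegrable f volume 0 R) ∧
    ∃ I : ℝ, Tendsto (fun R : ℝ => ∫ x in (0 : ℝ)..R, f x) atTop (𝓝 I)

/-- The improper integral `∫_0^∞ f(x) dx = lim_{R → ∞} ∫_0^R f(x) dx`
(meaningful when `ImproperConverges f`). -/
def improperIntegral (f : ℝ → ℝ) : ℝ :=
  limUnder atTop (fun R : ℝ => ∫ x in (0 : ℝ)..R, f x)

/-- `J_n = a₀ ∫_0^∞ ∏_{k=0}^n sinc(a_k x) dx`. -/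
def sincJ (a : ℕ → ℝ) (n : ℕ) : ℝ := a 0 * improperIntegral (sincProd a n)

/-- `t_n = (a₁ + ⋯ + aₙ - a₀)ⁿ / (2ⁿ⁻¹ n! ∏_{k=1}^n a_k)`. -/
def sincT (a : ℕ → ℝ) (n : ℕ) : ℝ :=
  (coeffSum a n - a 0) ^ n /
    ((2 : ℝ) ^ ((n : ℤ) - 1) * (n.factorial : ℝ) * ∏ k ∈ Finset.Icc 1 n, a k)

/-- `n ≥ 1` is the index at which the sum `a₁ + ⋯ + aₙ` first exceeds `a₀`:
`s(n-1) ≤ a₀ < s(n)`. -/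
def FirstExceeds (a : ℕ → ℝ) (n : ℕ) : Prop :=
  1 ≤ n ∧ coeffSum a (n - 1) ≤ a 0 ∧ a 0 < coeffSum a n

/-- The coefficients: `a₀` is a given integer and `a_k = 1/(2k-1)` for `k ≥ 1`. -/
def oddCoeff (a₀ : ℕ) (k : ℕ) : ℝ := if k = 0 then (a₀ : ℝ) else 1 / (2 * (k : ℝ) - 1)

end

/-!
For `b` real put `F_n(b) = ∫_0^∞ (sin (b x) / x) ∏_{k=1}^n sinc (a_k x) dx`, so that
`J_n = F_n(a₀)`. Since `(sin (b x) / x) sinc (a x)` is the average of `sin (u x) / x` over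
`b - a ≤ u ≤ b + a` (`dampedSine_succ`), `F_{n+1}` is obtained from `F_n` by averaging over
intervals of half-length `a_{n+1}`. The Dirichlet integral gives `F_0 = (π / 2) sign`, so
`(2 / π) F_n` is the sign function averaged `n` times (`iteratedSignAverage`). To pass from the
truncated integrals `∫_0^R` to the limit, dominated convergence is applied at each averaging step
(`tendsto_integral_dampedSine`); the constant bound it needs is that of the sine integral, and it
survives averaging. This treats the conditionally convergent case `n = 0` on the same footing as
the others.

The iterated average equals `1` at `b > 0` as soon as the window `[b - s(n), b + s(n)]` lies in
`[0, ∞)`. If `b` is below `s(n)` by at most `2 min a_k`, only the last power in the piecewise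
polynomial contributes, and `1 - (2 / π) F_n(b)` is a multiple of `(s(n) - b)₊ⁿ`
(`iteratedSignAverage_eq`).
At the first index with `a₀ < s(n)` the point `b = a₀` is in this range, because the `a_k`
decrease and `s(n) - 2 a_n < s(n - 1) ≤ a₀`.
-/

/-! ### The Dirichlet integral -/

theorem intervalIntegral_swap_of_continuous {f : ℝ → ℝ → ℝ}
    (hf : Continuous (Function.uncurry f)) {a b c d : ℝ} (hcd : c ≤ d) :
    ∫ x in a..b, ∫ y in c..d, f x y = ∫ y in c..d, ∫ x in a..b, f x y := by
  simp_rw [intervalIntegral.integral_of_le hcd]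
  apply intervalIntegral_integral_swap
  rw [Measure.prod_restrict]
  refine (hf.continuousOn.integrableOn_compact
    (isCompact_uIcc (a := a) (b := b) |>.prod (isCompact_Icc (a := c) (b := d)))).mono_set ?_
  exact Set.prod_mono Set.uIoc_subset_uIcc Set.Ioc_subset_Icc_self

theorem abs_sinc_le_inv_abs {x : ℝ} (hx : x ≠ 0) : |Real.sinc x| ≤ |x|⁻¹ := by
  rw [Real.sinc_of_ne_zero hx, abs_div, div_eq_mul_inv]
  exact mul_le_of_le_one_left (by positivity) (Real.abs_sin_le_one x)

theorem integral_exp_neg_mul_const {T R : ℝ} (hT : 0 < T) :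
    ∫ x in (0 : ℝ)..R, Real.exp (-x * T) = (1 - Real.exp (-R * T)) / T := by
  have h : ∀ x : ℝ, HasDerivAt (fun x => -Real.exp (-x * T) / T) (Real.exp (-x * T)) x := by
    intro x
    have := ((((hasDerivAt_id x).neg.mul_const T).exp).neg).div_const T
    refine HasDerivAt.congr_deriv this ?_
    simp
    field_simp
  rw [intervalIntegral.integral_eq_sub_of_hasDerivAt (fun x _ => h x)
    (by apply Continuous.intervalIntegrable; fun_prop)]
  simp
  ring

/-- Integrating `e^{-xt}` over `0 ≤ t ≤ T` turns `sin x` into `sinc x` up to the factor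
`1 - e^{-xT}`. -/
theorem integral_sin_mul_exp_neg {x T : ℝ} :
    ∫ t in (0 : ℝ)..T, Real.sin x * Real.exp (-x * t)
      = Real.sinc x * (1 - Real.exp (-x * T)) := by
  rcases eq_or_ne x 0 with rfl | hx
  · simp
  have h : ∀ t : ℝ, HasDerivAt (fun t => -(Real.sin x / x) * Real.exp (-x * t))
      (Real.sin x * Real.exp (-x * t)) t := by
    intro t
    have := (((hasDerivAt_id t).const_mul (-x)).exp).const_mul (-(Real.sin x / x))
    refine HasDerivAt.congr_deriv this ?_
    simp
    field_simp
  rw [intervalIntegral.integral_eq_sub_of_hasDerivAt (fun t _ => h t)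
    (by apply Continuous.intervalIntegrable; fun_prop), Real.sinc_of_ne_zero hx]
  simp
  ring

theorem integral_exp_neg_mul_sin {R t : ℝ} :
    ∫ x in (0 : ℝ)..R, Real.sin x * Real.exp (-x * t)
      = (1 + t ^ 2)⁻¹ -
        Real.exp (-R * t) * ((Real.cos R + t * Real.sin R) * (1 + t ^ 2)⁻¹) := by
  have ht : (1 + t ^ 2 : ℝ) ≠ 0 := by positivity
  have h : ∀ x : ℝ, HasDerivAt
      (fun x => -(Real.exp (-x * t) * ((Real.cos x + t * Real.sin x) * (1 + t ^ 2)⁻¹)))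
      (Real.sin x * Real.exp (-x * t)) x := by
    intro x
    have := ((((hasDerivAt_id x).neg.mul_const t).exp).mul
      (((Real.hasDerivAt_cos x).add ((Real.hasDerivAt_sin x).const_mul t)).mul_const
        (1 + t ^ 2)⁻¹)).neg
    refine HasDerivAt.congr_deriv this ?_
    simp
    field_simp
    ring
  rw [intervalIntegral.integral_eq_sub_of_hasDerivAt (fun x _ => h x)
    (by apply Continuous.intervalIntegrable; fun_prop)]
  simp
  ring

/-- A quantitative Dirichlet integral: evaluate `∫∫ sin x e^{-xt}` over `[0, R]²` in both
orders. -/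
theorem abs_integral_sinc_sub_arctan_le {R : ℝ} (hR : 0 < R) :
    |(∫ x in (0 : ℝ)..R, Real.sinc x) - Real.arctan R| ≤ 3 / R := by
  have key : (∫ x in (0 : ℝ)..R, Real.sinc x * (1 - Real.exp (-x * R)))
      = ∫ t in (0 : ℝ)..R, ((1 + t ^ 2)⁻¹ -
        Real.exp (-R * t) * ((Real.cos R + t * Real.sin R) * (1 + t ^ 2)⁻¹)) := by
    simp_rw [← integral_sin_mul_exp_neg, ← integral_exp_neg_mul_sin]
    exact intervalIntegral_swap_of_continuous
      (f := fun x t => Real.sin x * Real.exp (-x * t)) (by fun_prop) hR.le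
  have hc : Continuous fun t : ℝ => (1 + t ^ 2)⁻¹ :=
    Continuous.inv₀ (by fun_prop) (fun t => by positivity)
  have hi : ∀ {f : ℝ → ℝ}, Continuous f → IntervalIntegrable f volume 0 R :=
    fun hf => hf.intervalIntegrable _ _
  simp_rw [mul_sub, mul_one] at key
  rw [intervalIntegral.integral_sub (hi (by fun_prop)) (hi (by fun_prop)),
    intervalIntegral.integral_sub (hi hc) (hi (by fun_prop)), integral_inv_one_add_sq,
    Real.arctan_zero, sub_zero] at key
  have hexp : ∫ x in (0 : ℝ)..R, Real.exp (-x * R) ≤ 1 / R := by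
    rw [integral_exp_neg_mul_const hR]
    gcongr
    linarith [Real.exp_pos (-R * R)]
  have h1 : |∫ x in (0 : ℝ)..R, Real.sinc x * Real.exp (-x * R)| ≤ 1 / R := by
    rw [← Real.norm_eq_abs]
    refine le_trans ?_ hexp
    refine intervalIntegral.norm_integral_le_of_norm_le hR.le (ae_of_all _ fun x _ => ?_)
      (hi (f := fun x => Real.exp (-x * R)) (by fun_prop))
    rw [norm_mul, Real.norm_eq_abs, Real.norm_of_nonneg (Real.exp_nonneg _)]
    exact mul_le_of_le_one_left (Real.exp_nonneg _) (Real.abs_sinc_le_one x)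
  have h2 : |∫ t in (0 : ℝ)..R,
      Real.exp (-R * t) * ((Real.cos R + t * Real.sin R) * (1 + t ^ 2)⁻¹)| ≤ 2 / R := by
    have : ∫ t in (0 : ℝ)..R, Real.exp (-t * R) * 2 ≤ 2 / R := by
      rw [intervalIntegral.integral_mul_const]
      calc _ ≤ 1 / R * 2 := by gcongr
        _ = 2 / R := by ring
    rw [← Real.norm_eq_abs]
    refine le_trans ?_ this
    refine intervalIntegral.norm_integral_le_of_norm_le hR.le (ae_of_all _ fun t ht => ?_)
      (hi (f := fun t => Real.exp (-t * R) * 2) (by fun_prop))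
    rw [norm_mul, Real.norm_of_nonneg (Real.exp_nonneg _), show -R * t = -t * R by ring]
    gcongr
    rw [norm_mul, norm_inv, Real.norm_of_nonneg (by positivity : (0 : ℝ) ≤ 1 + t ^ 2),
      ← div_eq_mul_inv, div_le_iff₀ (by positivity), Real.norm_eq_abs]
    have ht0 : 0 ≤ t := ht.1.le
    calc |Real.cos R + t * Real.sin R| ≤ |Real.cos R| + |t * Real.sin R| := abs_add_le _ _
      _ ≤ 1 + t * 1 := by
        rw [abs_mul, abs_of_nonneg ht0]
        gcongr
        · exact Real.abs_cos_le_one R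
        · exact Real.abs_sin_le_one R
      _ ≤ 2 * (1 + t ^ 2) := by nlinarith [sq_nonneg (t - 1)]
  have h3 : (3 : ℝ) / R = 1 / R + 2 / R := by ring
  rw [abs_le] at h1 h2 ⊢
  constructor <;> linarith

theorem tendsto_integral_sinc_atTop :
    Tendsto (fun R : ℝ => ∫ x in (0 : ℝ)..R, Real.sinc x) atTop (𝓝 (Real.pi / 2)) := by
  have h1 : Tendsto (fun R : ℝ => (∫ x in (0 : ℝ)..R, Real.sinc x) - Real.arctan R) atTop
      (𝓝 0) := by
    refine squeeze_zero_norm' (a := fun R : ℝ => 3 / R) ?_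
      (tendsto_const_nhds.div_atTop tendsto_id)
    filter_upwards [eventually_gt_atTop 0] with R hR
    exact abs_integral_sinc_sub_arctan_le hR
  simpa using h1.add (Real.tendsto_arctan_atTop.mono_right nhdsWithin_le_nhds)

theorem integral_sinc_neg (R : ℝ) :
    ∫ x in (0 : ℝ)..(-R), Real.sinc x = -∫ x in (0 : ℝ)..R, Real.sinc x := by
  rw [← intervalIntegral.integral_symm]
  have := intervalIntegral.integral_comp_neg (a := 0) (b := R) Real.sinc
  simp only [Real.sinc_neg, neg_zero] at this
  rw [intervalIntegral.integral_symm, ← this, ← intervalIntegral.integral_symm]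

theorem abs_integral_sinc_le (R : ℝ) : |∫ x in (0 : ℝ)..R, Real.sinc x| ≤ 5 := by
  have hpos : ∀ R : ℝ, 0 ≤ R → |∫ x in (0 : ℝ)..R, Real.sinc x| ≤ 5 := by
    intro R hR
    rcases le_total R 1 with h | h
    · have := intervalIntegral.norm_integral_le_of_norm_le_const (a := 0) (b := R)
        (f := Real.sinc) (C := 1) (fun x _ => Real.abs_sinc_le_one x)
      rw [Real.norm_eq_abs, sub_zero, abs_of_nonneg hR] at this
      linarith
    · have h1 := abs_integral_sinc_sub_arctan_le (by linarith : 0 < R)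
      have h2 : 3 / R ≤ 3 := by
        rw [div_le_iff₀ (by linarith)]; linarith
      have h3 := Real.arctan_lt_pi_div_two R
      have h4 := Real.arctan_nonneg.2 hR
      have h5 := Real.pi_le_four
      rw [abs_le] at h1 ⊢
      constructor <;> linarith
  rcases le_total 0 R with h | h
  · exact hpos R h
  · have := hpos (-R) (by linarith)
    rwa [integral_sinc_neg, abs_neg] at this

/-! ### Products of sinc functions as iterated averages -/

/-- The function `x ↦ (sin (b x) / x) ∏_{k=1}^n sinc (a_k x)`, extended continuously to `x = 0`.
The frequency `b` is a free parameter, so that multiplication by a further `sinc` becomes an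
average over `b`. -/
noncomputable def dampedSine (a : ℕ → ℝ) (n : ℕ) (b x : ℝ) : ℝ :=
  b * Real.sinc (b * x) * ∏ k ∈ Finset.Icc 1 n, Real.sinc (a k * x)

/-- The sign function averaged successively over intervals of half-lengths `a₁, …, aₙ`. -/
noncomputable def iteratedSignAverage (a : ℕ → ℝ) : ℕ → ℝ → ℝ
  | 0, b => Real.sign b
  | n + 1, b =>
    (∫ u in (b - a (n + 1))..(b + a (n + 1)), iteratedSignAverage a n u) / (2 * a (n + 1))

theorem mul_sincProd_eq_dampedSine (a : ℕ → ℝ) (n : ℕ) (x : ℝ) :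
    a 0 * sincProd a n x = dampedSine a n (a 0) x := by
  rw [sincProd, dampedSine, Finset.range_eq_Ico, Finset.prod_eq_prod_Ico_succ_bot (by omega),
    mul_assoc]
  rfl

theorem continuous_sincProd (a : ℕ → ℝ) (n : ℕ) : Continuous (sincProd a n) := by
  unfold sincProd
  fun_prop

theorem continuous_uncurry_dampedSine (a : ℕ → ℝ) (n : ℕ) :
    Continuous (Function.uncurry (dampedSine a n)) := by
  unfold Function.uncurry dampedSine
  fun_prop

theorem integral_mul_sinc {c d x : ℝ} :
    ∫ u in (d - c)..(d + c), u * Real.sinc (u * x)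
      = 2 * c * (d * Real.sinc (d * x) * Real.sinc (c * x)) := by
  rcases eq_or_ne x 0 with rfl | hx
  · simp
    ring
  have h : ∀ u : ℝ, HasDerivAt (fun u => -Real.cos (u * x) / x ^ 2)
      (u * Real.sinc (u * x)) u := by
    intro u
    have := ((((hasDerivAt_id u).mul_const x).cos).neg).div_const (x ^ 2)
    refine HasDerivAt.congr_deriv this ?_
    rcases eq_or_ne u 0 with rfl | hu
    · simp
    rw [Real.sinc_of_ne_zero (mul_ne_zero hu hx)]
    simp
    field_simp
  rw [intervalIntegral.integral_eq_sub_of_hasDerivAt (fun u _ => h u)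
    (by apply Continuous.intervalIntegrable; fun_prop)]
  rcases eq_or_ne d 0 with rfl | hd
  · simp
  rcases eq_or_ne c 0 with rfl | hc
  · simp
  rw [Real.sinc_of_ne_zero (mul_ne_zero hd hx), Real.sinc_of_ne_zero (mul_ne_zero hc hx),
    add_mul, sub_mul, Real.cos_add, Real.cos_sub]
  field_simp
  ring

theorem dampedSine_succ {a : ℕ → ℝ} {n : ℕ} (ha : 0 < a (n + 1)) (b x : ℝ) :
    dampedSine a (n + 1) b x
      = (∫ u in (b - a (n + 1))..(b + a (n + 1)), dampedSine a n u x) / (2 * a (n + 1)) := by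
  simp only [dampedSine]
  rw [intervalIntegral.integral_mul_const, integral_mul_sinc,
    Finset.prod_Icc_succ_top (by omega)]
  field_simp

theorem integral_dampedSine_succ {a : ℕ → ℝ} {n : ℕ} (ha : 0 < a (n + 1)) (b R : ℝ) :
    ∫ x in (0 : ℝ)..R, dampedSine a (n + 1) b x
      = (∫ u in (b - a (n + 1))..(b + a (n + 1)), ∫ x in (0 : ℝ)..R, dampedSine a n u x) /
        (2 * a (n + 1)) := by
  simp_rw [dampedSine_succ ha]
  rw [intervalIntegral.integral_div, intervalIntegral_swap_of_continuous
    (f := fun x u => dampedSine a n u x)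
    ((continuous_uncurry_dampedSine a n).comp continuous_swap) (by linarith)]

theorem integral_dampedSine_zero (a : ℕ → ℝ) (b R : ℝ) :
    ∫ x in (0 : ℝ)..R, dampedSine a 0 b x = ∫ x in (0 : ℝ)..(b * R), Real.sinc x := by
  simp only [dampedSine, Finset.Icc_eq_empty_of_lt one_pos, Finset.prod_empty, mul_one]
  rw [intervalIntegral.integral_const_mul, intervalIntegral.mul_integral_comp_mul_left, mul_zero]

/-- Averaging preserves the uniform bound on the truncated integrals; this provides the
domination needed to exchange averages with the limit `R → ∞`. -/
theorem abs_integral_dampedSine_le {a : ℕ → ℝ} (ha : ∀ k, 1 ≤ k → 0 < a k) (n : ℕ) (b R : ℝ) :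
    |∫ x in (0 : ℝ)..R, dampedSine a n b x| ≤ 5 := by
  induction n generalizing b with
  | zero =>
    rw [integral_dampedSine_zero]
    exact abs_integral_sinc_le _
  | succ n ih =>
    have hn := ha (n + 1) (by omega)
    rw [integral_dampedSine_succ hn, abs_div, abs_of_pos (by positivity : 0 < 2 * a (n + 1)),
      div_le_iff₀ (by positivity)]
    refine (intervalIntegral.norm_integral_le_of_norm_le_const
      (f := fun u => ∫ x in (0 : ℝ)..R, dampedSine a n u x) (fun u _ => ih u)).trans ?_
    rw [show b + a (n + 1) - (b - a (n + 1)) = 2 * a (n + 1) by ring, abs_of_pos (by positivity)]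

theorem tendsto_integral_dampedSine {a : ℕ → ℝ} (ha : ∀ k, 1 ≤ k → 0 < a k) (n : ℕ) (b : ℝ) :
    Tendsto (fun R : ℝ => ∫ x in (0 : ℝ)..R, dampedSine a n b x) atTop
      (𝓝 (Real.pi / 2 * iteratedSignAverage a n b)) := by
  induction n generalizing b with
  | zero =>
    simp_rw [integral_dampedSine_zero, iteratedSignAverage]
    rcases lt_trichotomy b 0 with hb | rfl | hb
    · rw [Real.sign_of_neg hb, mul_neg, mul_one]
      have := (tendsto_integral_sinc_atTop.comp
        (tendsto_id.const_mul_atTop (neg_pos.2 hb))).neg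
      refine this.congr fun R => ?_
      simp [integral_sinc_neg]
    · simp
    · rw [Real.sign_of_pos hb, mul_one]
      exact tendsto_integral_sinc_atTop.comp (tendsto_id.const_mul_atTop hb)
  | succ n ih =>
    simp_rw [integral_dampedSine_succ (ha (n + 1) (by omega)), iteratedSignAverage]
    rw [← mul_div_assoc, ← intervalIntegral.integral_const_mul]
    refine Tendsto.div_const ?_ _
    refine intervalIntegral.tendsto_integral_filter_of_dominated_convergence (fun _ => 5)
      (Eventually.of_forall fun R => ?_)
      (Eventually.of_forall fun R => ae_of_all _ fun u _ => abs_integral_dampedSine_le ha n u R)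
      intervalIntegrable_const (ae_of_all _ fun u _ => ih u)
    exact (intervalIntegral.continuous_parametric_intervalIntegral_of_continuous'
      (continuous_uncurry_dampedSine a n) 0 R).aestronglyMeasurable

theorem improperConverges_sincProd {a : ℕ → ℝ} (h0 : 0 < a 0) (ha : ∀ k, 1 ≤ k → 0 < a k)
    (n : ℕ) : ImproperConverges (sincProd a n) := by
  refine ⟨fun R => (continuous_sincProd a n).intervalIntegrable _ _, _,
    ((tendsto_integral_dampedSine ha n (a 0)).const_mul (a 0)⁻¹).congr fun R => ?_⟩
  simp_rw [← mul_sincProd_eq_dampedSine]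
  rw [intervalIntegral.integral_const_mul, inv_mul_cancel_left₀ h0.ne']

theorem sincJ_eq_iteratedSignAverage {a : ℕ → ℝ} (h0 : 0 < a 0) (ha : ∀ k, 1 ≤ k → 0 < a k)
    (n : ℕ) : sincJ a n = Real.pi / 2 * iteratedSignAverage a n (a 0) := by
  have h := (tendsto_nhds_limUnder (improperConverges_sincProd h0 ha n).2).const_mul (a 0)
  refine tendsto_nhds_unique h ((tendsto_integral_dampedSine ha n (a 0)).congr fun R => ?_)
  simp_rw [← mul_sincProd_eq_dampedSine]
  rw [intervalIntegral.integral_const_mul]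

/-- Two decaying factors suffice for absolute convergence: they bound the product by a multiple
of `(1 + x ^ 2)⁻¹`. -/
theorem integrable_sincProd {a : ℕ → ℝ} (h0 : 0 < a 0) (ha : ∀ k, 1 ≤ k → 0 < a k)
    {n : ℕ} (hn : 1 ≤ n) : Integrable (sincProd a n) := by
  have h1 := ha 1 le_rfl
  refine (integrable_inv_one_add_sq.const_mul (1 + (a 0 * a 1)⁻¹)).mono'
    (continuous_sincProd a n).aestronglyMeasurable (ae_of_all _ fun x => ?_)
  have hle : ‖sincProd a n x‖ ≤ |Real.sinc (a 0 * x)| * |Real.sinc (a 1 * x)| := by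
    rw [sincProd, norm_prod, ← Finset.prod_sdiff (s₁ := Finset.range 2)
      (Finset.range_subset_range.2 (by omega))]
    rw [Finset.prod_range_succ, Finset.prod_range_one]
    refine mul_le_of_le_one_left (by positivity) ?_
    exact Finset.prod_le_one (fun _ _ => norm_nonneg _) fun k _ => Real.abs_sinc_le_one _
  refine hle.trans ?_
  rw [← div_eq_mul_inv, le_div_iff₀ (by positivity), mul_add, mul_one]
  refine add_le_add (mul_le_one₀ (Real.abs_sinc_le_one _) (abs_nonneg _)
    (Real.abs_sinc_le_one _)) ?_
  rcases eq_or_ne x 0 with rfl | hx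
  · simp
    positivity
  calc |Real.sinc (a 0 * x)| * |Real.sinc (a 1 * x)| * x ^ 2
      ≤ |a 0 * x|⁻¹ * |a 1 * x|⁻¹ * x ^ 2 := by
        gcongr
        · exact abs_sinc_le_inv_abs (mul_ne_zero h0.ne' hx)
        · exact abs_sinc_le_inv_abs (mul_ne_zero h1.ne' hx)
    _ = (a 0 * a 1)⁻¹ := by
        rw [abs_mul, abs_mul, abs_of_pos h0, abs_of_pos h1, ← sq_abs x]
        field_simp

/-! ### Evaluation of the averages near the upper end of their range -/

/-- The truncated power `x₊ⁿ`, with `x₊⁰` the indicator of `x > 0`. -/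
noncomputable def truncPow (n : ℕ) (x : ℝ) : ℝ := if 0 < x then x ^ n else 0

theorem intervalIntegrable_truncPow (n : ℕ) (y z : ℝ) :
    IntervalIntegrable (truncPow n) volume y z := by
  have hx : truncPow n = Set.indicator (Set.Ioi 0) fun x => x ^ n := by
    ext x
    simp [truncPow, Set.indicator]
  rw [hx, intervalIntegrable_iff]
  exact ((intervalIntegrable_iff.1 ((continuous_pow n).intervalIntegrable y z))).indicator
    measurableSet_Ioi

theorem integral_truncPow {n : ℕ} {y z : ℝ} (hy : y ≤ 0) (hyz : y ≤ z) :
    ∫ x in y..z, truncPow n x = truncPow (n + 1) z / (n + 1) := by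
  have hzero : ∀ w ≤ (0 : ℝ), y ≤ w → ∫ x in y..w, truncPow n x = 0 := by
    intro w hw hyw
    refine intervalIntegral.integral_zero_ae (ae_of_all _ fun x hx => ?_)
    rw [Set.uIoc_of_le hyw] at hx
    exact if_neg (not_lt.2 (hx.2.trans hw))
  rcases le_or_gt z 0 with hz | hz
  · rw [hzero z hz hyz, truncPow, if_neg (not_lt.2 hz), zero_div]
  have hEq : ∀ x ∈ Set.uIoc 0 z, x ^ n = truncPow n x := by
    intro x hx
    rw [Set.uIoc_of_le hz.le] at hx
    exact (if_pos hx.1).symm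
  rw [← intervalIntegral.integral_add_adjacent_intervals
    (intervalIntegrable_truncPow n y 0) (intervalIntegrable_truncPow n 0 z),
    hzero 0 le_rfl hy, zero_add,
    ← intervalIntegral.integral_congr_ae (ae_of_all _ hEq), integral_pow, truncPow, if_pos hz]
  simp

theorem coeffSum_succ (a : ℕ → ℝ) (n : ℕ) : coeffSum a (n + 1) = coeffSum a n + a (n + 1) :=
  Finset.sum_Icc_succ_top (by omega) _

/-- Within `2d` of the end `s(n)`, where `d` bounds all half-lengths from below, the iterated
average differs from `1` by a single truncated power: each averaging step integrates the
truncated power once. For `n = 0` this is the shape of the sign function away from `0`. -/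
theorem iteratedSignAverage_eq {a : ℕ → ℝ} (ha : ∀ k, 1 ≤ k → 0 < a k) {d : ℝ} (n : ℕ)
    (hd : ∀ k, 1 ≤ k → k ≤ n → d ≤ a k) {b : ℝ} (hb : coeffSum a n - 2 * d ≤ b)
    (hne : n = 0 → b ≠ 0) :
    iteratedSignAverage a n b = 1 - 2 / (2 ^ n * n.factorial * ∏ k ∈ Finset.Icc 1 n, a k) *
      truncPow n (coeffSum a n - b) := by
  induction n generalizing b with
  | zero =>
    rcases lt_or_gt_of_ne (hne rfl) with h | h
    · simp [iteratedSignAverage, truncPow, coeffSum, h, Real.sign_of_neg h]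
      norm_num
    · simp [iteratedSignAverage, truncPow, coeffSum, h.not_gt, Real.sign_of_pos h]
  | succ n ih =>
    have hn := ha (n + 1) (by omega)
    have hdn := hd (n + 1) (by omega) le_rfl
    rw [coeffSum_succ] at hb
    have hP : ∏ k ∈ Finset.Icc 1 n, a k ≠ 0 :=
      Finset.prod_ne_zero_iff.2 fun k hk => (ha k (Finset.mem_Icc.1 hk).1).ne'
    have hcongr : ∫ u in (b - a (n + 1))..(b + a (n + 1)), iteratedSignAverage a n u
        = ∫ u in (b - a (n + 1))..(b + a (n + 1)),
          (1 - 2 / (2 ^ n * n.factorial * ∏ k ∈ Finset.Icc 1 n, a k) *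
            truncPow n (coeffSum a n - u)) := by
      refine intervalIntegral.integral_congr_ae ?_
      -- The formula for `n = 0` fails at `u = 0`, a null set for the averaging integral.
      filter_upwards [compl_mem_ae_iff.2 (measure_singleton (0 : ℝ))] with u hu0 hu
      rw [Set.uIoc_of_le (by linarith)] at hu
      exact ih (fun k h1 hk => hd k h1 (by omega)) (by linarith [hu.1]) fun _ => hu0
    rw [iteratedSignAverage, hcongr, intervalIntegral.integral_sub intervalIntegrable_const,
      intervalIntegral.integral_const_mul,
      intervalIntegral.integral_comp_sub_left (truncPow n) (coeffSum a n),
      integral_truncPow (by linarith) (by linarith), intervalIntegral.integral_const,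
      coeffSum_succ, Finset.prod_Icc_succ_top (by omega), Nat.factorial_succ,
      show coeffSum a n - (b - a (n + 1)) = coeffSum a n + a (n + 1) - b by ring]
    · have hf : (n.factorial : ℝ) ≠ 0 := by positivity
      push_cast
      simp only [smul_eq_mul]
      field_simp
      ring
    · refine IntervalIntegrable.const_mul ?_ _
      simpa using (intervalIntegrable_truncPow n (coeffSum a n - (b - a (n + 1)))
        (coeffSum a n - (b + a (n + 1)))).comp_sub_left (coeffSum a n)

/-! ### The coefficients `1, 1/3, 1/5, …` -/

theorem oddCoeff_zero (a₀ : ℕ) : oddCoeff a₀ 0 = a₀ := if_pos rfl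

theorem oddCoeff_of_one_le (a₀ : ℕ) {k : ℕ} (hk : 1 ≤ k) :
    oddCoeff a₀ k = 1 / (2 * (k : ℝ) - 1) := if_neg (by omega)

theorem oddCoeff_pos (a₀ : ℕ) {k : ℕ} (hk : 1 ≤ k) : 0 < oddCoeff a₀ k := by
  rw [oddCoeff_of_one_le a₀ hk]
  have : (1 : ℝ) ≤ k := by exact_mod_cast hk
  exact one_div_pos.2 (by linarith)

theorem oddCoeff_le (a₀ : ℕ) {k n : ℕ} (hk : 1 ≤ k) (hkn : k ≤ n) :
    oddCoeff a₀ n ≤ oddCoeff a₀ k := by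
  rw [oddCoeff_of_one_le a₀ hk, oddCoeff_of_one_le a₀ (hk.trans hkn)]
  have h1 : (1 : ℝ) ≤ k := by exact_mod_cast hk
  have h2 : (k : ℝ) ≤ n := by exact_mod_cast hkn
  exact one_div_le_one_div_of_le (by linarith) (by linarith)

theorem strictMono_coeffSum {a : ℕ → ℝ} (ha : ∀ k, 1 ≤ k → 0 < a k) :
    StrictMono (coeffSum a) :=
  strictMono_nat_of_lt_succ fun n => by
    rw [coeffSum_succ]
    linarith [ha (n + 1) (by omega)]

theorem tendsto_coeffSum_oddCoeff (a₀ : ℕ) :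
    Tendsto (coeffSum (oddCoeff a₀)) atTop atTop := by
  -- Since `1 / (2k - 1) ≥ 1 / (2k)`, half the harmonic series is a lower bound.
  refine tendsto_atTop_mono (fun n => ?_)
    (Real.tendsto_sum_range_one_div_nat_succ_atTop.const_mul_atTop (r := 1 / 2) (by norm_num))
  induction n with
  | zero => simp [coeffSum]
  | succ n ih =>
    rw [coeffSum_succ, Finset.sum_range_succ, mul_add]
    refine add_le_add ih ?_
    rw [oddCoeff_of_one_le a₀ (by omega), one_div_mul_one_div]
    push_cast
    exact one_div_le_one_div_of_le (by linarith [(n.cast_nonneg : (0 : ℝ) ≤ n)]) (by linarith)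

theorem existsUnique_firstExceeds {a : ℕ → ℝ} (h0 : 0 ≤ a 0) (ha : ∀ k, 1 ≤ k → 0 < a k)
    (hdiv : Tendsto (coeffSum a) atTop atTop) : ∃! n, FirstExceeds a n := by
  have hex : ∃ n, a 0 < coeffSum a n := (hdiv.eventually_gt_atTop (a 0)).exists
  have hmono := strictMono_coeffSum ha
  classical
  refine ⟨Nat.find hex, ⟨?_, ?_, Nat.find_spec hex⟩, fun m hm => ?_⟩
  · rw [Nat.one_le_iff_ne_zero, Ne, Nat.find_eq_zero]
    simpa [coeffSum] using h0
  · rcases Nat.eq_zero_or_pos (Nat.find hex) with h | h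
    · rw [h]
      simpa [coeffSum] using h0
    · exact not_lt.1 (Nat.find_min hex (by omega))
  · refine le_antisymm (not_lt.1 fun hlt => ?_) (Nat.find_min' hex hm.2.2)
    have : coeffSum a (Nat.find hex) ≤ coeffSum a (m - 1) := hmono.monotone (by omega)
    linarith [Nat.find_spec hex, hm.2.1]

theorem prod_oddCoeff (a₀ n : ℕ) :
    ∏ k ∈ Finset.Icc 1 n, oddCoeff a₀ k = 2 ^ n * n.factorial / (2 * n).factorial := by
  induction n with
  | zero => simp
  | succ n ih =>
    rw [Finset.prod_Icc_succ_top (by omega), ih, oddCoeff_of_one_le a₀ (by omega),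
      show 2 * (n + 1) = 2 * n + 1 + 1 by ring, Nat.factorial_succ, Nat.factorial_succ,
      Nat.factorial_succ]
    have h : ((2 * n).factorial : ℝ) ≠ 0 := by positivity
    have h' : (2 * (n : ℝ) + 1) ≠ 0 := by positivity
    push_cast
    rw [show 2 * ((n : ℝ) + 1) - 1 = 2 * n + 1 by ring]
    field_simp
    ring

/-! ### The values of the integrals -/

theorem sincJ_eq_of_firstExceeds {a : ℕ → ℝ} (h0 : 0 < a 0) (ha : ∀ k, 1 ≤ k → 0 < a k)
    {n : ℕ} (hanti : ∀ k, 1 ≤ k → k ≤ n → a n ≤ a k) (hn : FirstExceeds a n) :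
    sincJ a n = Real.pi / 2 * (1 - sincT a n) := by
  obtain ⟨h1, h2, h3⟩ := hn
  obtain ⟨m, rfl⟩ := Nat.exists_eq_add_of_le' h1
  have hm := ha (m + 1) h1
  rw [Nat.add_sub_cancel] at h2
  -- `s(n) - 2 aₙ = s(n - 1) - aₙ` is less than `a₀`, so `d = aₙ` is admissible.
  rw [sincJ_eq_iteratedSignAverage h0 ha, iteratedSignAverage_eq ha (d := a (m + 1)) _ hanti
    (by rw [coeffSum_succ]; linarith) (fun h => by omega), truncPow, if_pos (sub_pos.2 h3), sincT,
    zpow_sub_one₀ two_ne_zero, zpow_natCast]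
  have hP : ∏ k ∈ Finset.Icc 1 (m + 1), a k ≠ 0 :=
    Finset.prod_ne_zero_iff.2 fun k hk => (ha k (Finset.mem_Icc.1 hk).1).ne'
  have hf : ((m + 1).factorial : ℝ) ≠ 0 := by positivity
  field_simp

theorem sincJ_eq_of_coeffSum_le {a : ℕ → ℝ} (h0 : 0 < a 0) (ha : ∀ k, 1 ≤ k → 0 < a k)
    {n : ℕ} (hn : coeffSum a n ≤ a 0) : sincJ a n = Real.pi / 2 := by
  rw [sincJ_eq_iteratedSignAverage h0 ha, iteratedSignAverage_eq ha (d := 0) n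
    (fun k hk _ => (ha k hk).le) (by linarith) (fun _ => h0.ne'), truncPow,
    if_neg (not_lt.2 (sub_nonpos.2 hn))]
  simp

theorem mainTheorem1 (a₀ : ℕ) (ha₀ : 1 ≤ a₀) :
    (∃! n : ℕ, FirstExceeds (oddCoeff a₀) n) ∧
    ∀ n : ℕ,
      ImproperConverges (sincProd (oddCoeff a₀) n) ∧
      (1 ≤ n → IntegrableOn (sincProd (oddCoeff a₀) n) (Set.Ioi 0) volume) ∧
      (FirstExceeds (oddCoeff a₀) n →
        sincJ (oddCoeff a₀) n = Real.pi / 2 * (1 - sincT (oddCoeff a₀) n) ∧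
        sincT (oddCoeff a₀) n =
          (coeffSum (oddCoeff a₀) n - (a₀ : ℝ)) ^ n / (2 : ℝ) ^ (2 * (n : ℤ) - 1) *
            (((2 * n).factorial : ℝ) / (n.factorial : ℝ) ^ 2)) ∧
      (coeffSum (oddCoeff a₀) n ≤ (a₀ : ℝ) →
        sincJ (oddCoeff a₀) n = Real.pi / 2) := by
  have h0 : 0 < oddCoeff a₀ 0 := by
    rw [oddCoeff_zero]
    exact_mod_cast ha₀
  have ha : ∀ k, 1 ≤ k → 0 < oddCoeff a₀ k := fun k hk => oddCoeff_pos a₀ hk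
  refine ⟨existsUnique_firstExceeds h0.le ha (tendsto_coeffSum_oddCoeff a₀), fun n =>
    ⟨improperConverges_sincProd h0 ha n, fun hn => (integrable_sincProd h0 ha hn).integrableOn,
      fun hn => ⟨sincJ_eq_of_firstExceeds h0 ha (fun k hk hkn => oddCoeff_le a₀ hk hkn) hn, ?_⟩,
      fun hn => sincJ_eq_of_coeffSum_le h0 ha (by rwa [oddCoeff_zero])⟩⟩
  have h2n : (2 : ℝ) ^ (2 * (n : ℤ) - 1) = 2 ^ n * 2 ^ n / 2 := by
    rw [zpow_sub_one₀ two_ne_zero, two_mul, zpow_add₀ two_ne_zero, zpow_natCast, div_eq_mul_inv]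
  rw [sincT, prod_oddCoeff, oddCoeff_zero, h2n, zpow_sub_one₀ two_ne_zero, zpow_natCast]
  have hf : (n.factorial : ℝ) ≠ 0 := by positivity
  have hf2 : ((2 * n).factorial : ℝ) ≠ 0 := by positivity
  field_simp
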